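/- Let $n,m,p,q,T\ge 0$ and $\bar h\ge 1$ be integers, $A_0,A_1\in\mathbb R^{n\times n}$, $B\in\mathbb R^{n\times m}$, $D_0\in\mathbb R^{n\times p}$, $L_1,L_2\in\mathbb R^{q\times n}$, $D\in\mathbb R^{q\times m}$. For $K\in\mathbb R^{m\times n}$ and time-varying delays $h_1,h_2:\mathbb Z_{\ge0}\to\{0,\dots,\bar h\}$ consider the closed-loop system with disturbance $\omega(k)\in\mathbb R^p$ and performance output $z(k)\in\mathbb R^q$, $$x(k+1)=A_0x(k)+A_1x(k-h_1(k))+BKx(k-h_2(k))+D_0\omega(k),\qquad z(k)=L_1x(k)+L_2x(k-h_1(k))+DKx(k-h_2(k)).$$ *Data.* Let $u_{\rm d}:\mathbb Z\to\mathbb R^m$ and $x_{\rm d}:\mathbb Z\to\mathbb R^n$ be recorded sequences that satisfy, for constants $d_1,d_2\in\{0,\dots,\bar h\}$, the undisturbed system $x_{\rm d}(k+1)=A_0x_{\rm d}(k)+A_1x_{\rm d}(k-d_1)+Bu_{\rm d}(k-d_2)$ for $k=0,\dots,T-1$. Let $U$, $X_h$, $X_0$, $X_1$ be the matrices whose $T$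 columns, for $k=0,\dots,T-1$, are $u_{\rm d}(k-d_2)$, $x_{\rm d}(k-d_1)$, $x_{\rm d}(k)$, $x_{\rm d}(k+1)$ respectively, and suppose that $W_0=\begin{bmatrix}U\\X_h\\X_0\end{bmatrix}$ has rank $m+2n$. *Conditions.* Let $\gamma>0$ and $\varepsilon>0$. Suppose that there are symmetric positive definite matrices $\bar P,\bar S,\bar R_1,\bar R_2\in\mathbb R^{n\times n}$, matrices $\bar S_{12,1},\bar S_{12,2}\in\mathbb R^{n\times n}$ and $Q_1,Q_2,Q_3\in\mathbb R^{T\times n}$ with $$UQ_2=UQ_3=0,\quad X_hQ_1=X_hQ_3=0,\quad X_0Q_1=X_0Q_2=0,\quad X_hQ_2=X_0Q_3,$$ $$\begin{bmatrix}\bar R_i&\bar S_{12,i}\\\bar S_{12,i}^\top&\bar R_i\end{bmatrix}\ge0\ (i=1,2),\qquad \bar\Gamma=\begin{bmatrix}\bar\Phi&\kappa^\top&\kappa_{\omega}^\top\\\star&I_q&0\\\star&\star&\gamma I_p\end{bmatrix}>0,$$ where $\star$ denotes blocks determined by symmetry, $\kappa=[L_1X_0Q_3,\ L_2X_0Q_3,\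 DUQ_1,\ 0,\ 0]$, $\kappa_{\omega}=[-D_0^\top,\ 0,\ 0,\ 0,\ -\varepsilon D_0^\top]$ and $$\bar\Phi=\begin{bmatrix}\bar\Phi_{11}&\bar\Phi_{12}&\bar\Phi_{13}&-\bar S_{12,1}-\bar S_{12,2}&\bar\Phi_{15}\\ \star&2\bar R_1-\bar S_{12,1}-\bar S_{12,1}^\top&0&-\bar R_1+\bar S_{12,1}&-\varepsilon(X_1Q_2)^\top\\ \star&\star&2\bar R_2-\bar S_{12,2}-\bar S_{12,2}^\top&-\bar R_2+\bar S_{12,2}&-\varepsilon(X_1Q_1)^\top\\ \star&\star&\star&\bar R_1+\bar R_2+\bar S&0\\ \star&\star&\star&\star&\bar\Phi_{55}\end{bmatrix},$$ with $\bar\Phi_{11}=\bar P-\bar S+(1-\bar h^2)(\bar R_1+\bar R_2)-X_1Q_3-(X_1Q_3)^\top$, $\bar\Phi_{12}=-\bar R_1+\bar S_{12,1}-X_1Q_2$, $\bar\Phi_{13}=-\bar R_2+\bar S_{12,2}-X_1Q_1$, $\bar\Phi_{15}=\bar h^2(\bar R_1+\bar R_2)+X_0Q_3-\varepsilon(X_1Q_3)^\top$,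 $\bar\Phi_{55}=-\bar P-\bar h^2(\bar R_1+\bar R_2)+\varepsilon(X_0Q_3+Q_3^\top X_0^\top)$. *Conclusion.* Let $K=UQ_1(X_0Q_3)^{-1}$. Then for all delays $h_1,h_2:\mathbb Z_{\ge0}\to\{0,\dots,\bar h\}$: 1. for $\omega=0$ the origin is exponentially stable: there are $M>0$ and $\rho\in(0,1)$ such that, for every initial time $k_0\ge0$ and every solution $x$ on $k\ge k_0$, $\|x(k_0+i)\|_2\le M\rho^{i}\max_{k_0-\bar h\le j\le k_0}\|x(j)\|_2$ for all $i\ge0$; 2. the system has $L_2$-gain less than $\gamma$, the $L_2$-gain being the maximum energy amplification ratio $$\sup\Big\{\frac{\sum_{k\ge0}z(k)^\top z(k)}{\sum_{k\ge0}\omega(k)^\top\omega(k)}\ :\ 0<\sum_{k\ge0}\omega(k)^\top\omega(k)<\infty,\ x(j)=0\text{ for }-\bar h\le j\le0\Big\}<\gamma .$$ -/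

import Mathlib

open Matrix
open scoped ENNReal

namespace DelayHinf

noncomputable section

/-- The Euclidean norm `‖v‖₂ = √(vᵀ v)` of a vector `v ∈ ℝⁿ`. -/
def euclNorm {n : ℕ} (v : Fin n → ℝ) : ℝ := Real.sqrt (v ⬝ᵥ v)

/-- The data matrix `[s(i)  s(i+1)  ⋯  s(i+T-1)]` of a signal `s : ℤ → ℝⁿ`. -/
def dataMatrix {n : ℕ} (s : ℤ → Fin n → ℝ) (i : ℤ) (T : ℕ) : Matrix (Fin n) (Fin T) ℝ :=
  Matrix.of fun r c => s (i + (c : ℤ)) r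

/-- The signal `k ↦ s(k - h)` for a constant delay `h`. -/
def delayed {n : ℕ} (s : ℤ → Fin n → ℝ) (h : ℕ) : ℤ → Fin n → ℝ := fun k => s (k - (h : ℤ))

/-- The recorded input-state data `(u, x)` on the window `0, …, T-1` were produced by
`x(k+1) = A₀ x(k) + A₁ x(k - h₁) + B u(k - h₂)` with constant delays `h₁`, `h₂`. -/
def IsRecordedData {n m : ℕ} (A₀ A₁ : Matrix (Fin n) (Fin n) ℝ) (B : Matrix (Fin n) (Fin m) ℝ)
    (h₁ h₂ T : ℕ) (u : ℤ → Fin m → ℝ) (x : ℤ → Fin n → ℝ) : Prop :=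
  ∀ k : ℕ, k < T →
    x ((k : ℤ) + 1) = A₀ *ᵥ x (k : ℤ) + A₁ *ᵥ delayed x h₁ (k : ℤ) + B *ᵥ delayed u h₂ (k : ℤ)

/-- `W₀`: the matrices `U`, `Xh`, `X` stacked on top of each other. -/
def dataW {n m T : ℕ} (U : Matrix (Fin m) (Fin T) ℝ) (Xh X : Matrix (Fin n) (Fin T) ℝ) :
    Matrix (Fin m ⊕ (Fin n ⊕ Fin n)) (Fin T) ℝ :=
  fromRows U (fromRows Xh X)

/-- The `2 × 2` block matrix `[A B; ⋆ D]`, the entry `⋆` being `Bᵀ`. -/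
def symBlock {ι κ : Type} (A : Matrix ι ι ℝ) (B : Matrix ι κ ℝ) (D : Matrix κ κ ℝ) :
    Matrix (ι ⊕ κ) (ι ⊕ κ) ℝ :=
  fromBlocks A B Bᵀ D

/-- Five blocks of size `n`. -/
abbrev Five (n : ℕ) : Type := Fin n ⊕ (Fin n ⊕ (Fin n ⊕ (Fin n ⊕ Fin n)))

/-- A row of five blocks. -/
def row5 {ι : Type} {n : ℕ} (M₁ M₂ M₃ M₄ M₅ : Matrix ι (Fin n) ℝ) : Matrix ι (Five n) ℝ :=
  fromCols M₁ (fromCols M₂ (fromCols M₃ (fromCols M₄ M₅)))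

/-- The symmetric `5n × 5n` matrix of the stabilization condition, given by its upper block
triangle. Here `X₀`, `X₁` are the data matrices of `x(k)` and `x(k+1)`. -/
def PhiBar {n T : ℕ} (hbar : ℕ) (ε : ℝ) (X₀ X₁ : Matrix (Fin n) (Fin T) ℝ)
    (P S R₁ R₂ S₁ S₂ : Matrix (Fin n) (Fin n) ℝ) (Q₁ Q₂ Q₃ : Matrix (Fin T) (Fin n) ℝ) :
    Matrix (Five n) (Five n) ℝ :=
  symBlock (P - S + (1 - (hbar : ℝ) ^ 2) • (R₁ + R₂) - X₁ * Q₃ - (X₁ * Q₃)ᵀ)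
    (fromCols (-R₁ + S₁ - X₁ * Q₂)
      (fromCols (-R₂ + S₂ - X₁ * Q₁)
        (fromCols (-S₁ - S₂)
          ((hbar : ℝ) ^ 2 • (R₁ + R₂) + X₀ * Q₃ - ε • (X₁ * Q₃)ᵀ))))
    (symBlock ((2 : ℝ) • R₁ - S₁ - S₁ᵀ)
      (fromCols 0 (fromCols (-R₁ + S₁) (-(ε • (X₁ * Q₂)ᵀ))))
      (symBlock ((2 : ℝ) • R₂ - S₂ - S₂ᵀ)
        (fromCols (-R₂ + S₂) (-(ε • (X₁ * Q₁)ᵀ)))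
        (symBlock (R₁ + R₂ + S) 0
          (-P - (hbar : ℝ) ^ 2 • (R₁ + R₂) + ε • (X₀ * Q₃ + Q₃ᵀ * X₀ᵀ)))))

/-- The row `κ = [L₁ X₀ Q₃, L₂ X₀ Q₃, D U Q₁, 0, 0]`. -/
def kappa {n m q T : ℕ} (L₁ L₂ : Matrix (Fin q) (Fin n) ℝ) (D : Matrix (Fin q) (Fin m) ℝ)
    (U : Matrix (Fin m) (Fin T) ℝ) (X₀ : Matrix (Fin n) (Fin T) ℝ)
    (Q₁ Q₃ : Matrix (Fin T) (Fin n) ℝ) : Matrix (Fin q) (Five n) ℝ :=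
  row5 (L₁ * X₀ * Q₃) (L₂ * X₀ * Q₃) (D * U * Q₁) 0 0

/-- The row `κ₂ = [-D₀ᵀ, 0, 0, 0, -ε D₀ᵀ, 0]`, the last block having width `q`. -/
def kappa₂ {n p : ℕ} (q : ℕ) (ε : ℝ) (D₀ : Matrix (Fin n) (Fin p) ℝ) :
    Matrix (Fin p) (Five n ⊕ Fin q) ℝ :=
  fromCols (row5 (-D₀ᵀ) 0 0 0 (-(ε • D₀ᵀ))) 0

/-- `[Φ κᵀ; ⋆ I]`. -/
def PsiBar {n q : ℕ} (Φ : Matrix (Five n) (Five n) ℝ) (κ : Matrix (Fin q) (Five n) ℝ) :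
    Matrix (Five n ⊕ Fin q) (Five n ⊕ Fin q) ℝ :=
  symBlock Φ κᵀ 1

/-- `[Ψ κ₂ᵀ; ⋆ γ I]`. -/
def GammaBar {n p q : ℕ} (γ : ℝ) (Ψ : Matrix (Five n ⊕ Fin q) (Five n ⊕ Fin q) ℝ)
    (κ₂ : Matrix (Fin p) (Five n ⊕ Fin q) ℝ) :
    Matrix ((Five n ⊕ Fin q) ⊕ Fin p) ((Five n ⊕ Fin q) ⊕ Fin p) ℝ :=
  symBlock Ψ κ₂ᵀ (γ • (1 : Matrix (Fin p) (Fin p) ℝ))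

/-- `x` solves, for all `k ≥ k₀`, the closed-loop system
`x(k+1) = A₀ x(k) + A₁ x(k - h₁(k)) + B K x(k - h₂(k)) + D₀ ω(k)`. -/
def IsTrajectory {n m p : ℕ} (A₀ A₁ : Matrix (Fin n) (Fin n) ℝ) (B : Matrix (Fin n) (Fin m) ℝ)
    (K : Matrix (Fin m) (Fin n) ℝ) (D₀ : Matrix (Fin n) (Fin p) ℝ) (h₁ h₂ : ℕ → ℕ) (k₀ : ℕ)
    (ω : ℕ → Fin p → ℝ) (x : ℤ → Fin n → ℝ) : Prop :=
  ∀ k : ℕ, k₀ ≤ k →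
    x ((k : ℤ) + 1) = A₀ *ᵥ x (k : ℤ) + A₁ *ᵥ x ((k : ℤ) - (h₁ k : ℤ))
      + (B * K) *ᵥ x ((k : ℤ) - (h₂ k : ℤ)) + D₀ *ᵥ ω k

/-- The performance output `z(k) = L₁ x(k) + L₂ x(k - h₁(k)) + D K x(k - h₂(k))`. -/
def output {n m q : ℕ} (L₁ L₂ : Matrix (Fin q) (Fin n) ℝ) (D : Matrix (Fin q) (Fin m) ℝ)
    (K : Matrix (Fin m) (Fin n) ℝ) (h₁ h₂ : ℕ → ℕ) (x : ℤ → Fin n → ℝ) : ℕ → Fin q → ℝ :=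
  fun k => L₁ *ᵥ x (k : ℤ) + L₂ *ᵥ x ((k : ℤ) - (h₁ k : ℤ))
    + (D * K) *ᵥ x ((k : ℤ) - (h₂ k : ℤ))

/-- The origin of the undisturbed (`ω = 0`) closed-loop system with the time-varying delays
`h₁`, `h₂` is exponentially stable: `‖x(k₀ + i)‖ ≤ M ρ ^ i max_{k₀ - hbar ≤ j ≤ k₀} ‖x(j)‖` with
constants `M > 0` and `0 < ρ < 1` that depend neither on the initial time `k₀` nor on the
initial history. -/
def IsExpStable {n m p : ℕ} (A₀ A₁ : Matrix (Fin n) (Fin n) ℝ) (B : Matrix (Fin n) (Fin m) ℝ)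
    (K : Matrix (Fin m) (Fin n) ℝ) (D₀ : Matrix (Fin n) (Fin p) ℝ) (hbar : ℕ)
    (h₁ h₂ : ℕ → ℕ) : Prop :=
  ∃ M ρ : ℝ, 0 < M ∧ 0 < ρ ∧ ρ < 1 ∧
    ∀ (k₀ : ℕ) (x : ℤ → Fin n → ℝ), IsTrajectory A₀ A₁ B K D₀ h₁ h₂ k₀ (fun _ => 0) x →
      ∀ c : ℝ, (∀ j : ℤ, (k₀ : ℤ) - (hbar : ℤ) ≤ j → j ≤ (k₀ : ℤ) → euclNorm (x j) ≤ c) →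
        ∀ i : ℕ, euclNorm (x ((k₀ : ℤ) + (i : ℤ))) ≤ M * ρ ^ i * c

/-- The energy `∑ₖ s(k)ᵀ s(k) ∈ [0, ∞]` of a signal. -/
def energy {q : ℕ} (s : ℕ → Fin q → ℝ) : ℝ≥0∞ := ∑' k : ℕ, ENNReal.ofReal (s k ⬝ᵥ s k)

/-- The `L₂`-gain, as the maximum energy amplification ratio from the disturbance `ω` to the
output `z`: the supremum of `(∑ₖ z(k)ᵀ z(k)) / (∑ₖ ω(k)ᵀ ω(k))` over all nonzero disturbances of
finite energy, for zero initial history. -/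
def l2Gain {n m p q : ℕ} (A₀ A₁ : Matrix (Fin n) (Fin n) ℝ) (B : Matrix (Fin n) (Fin m) ℝ)
    (K : Matrix (Fin m) (Fin n) ℝ) (D₀ : Matrix (Fin n) (Fin p) ℝ)
    (L₁ L₂ : Matrix (Fin q) (Fin n) ℝ) (D : Matrix (Fin q) (Fin m) ℝ) (hbar : ℕ)
    (h₁ h₂ : ℕ → ℕ) : ℝ≥0∞ :=
  sSup {r : ℝ≥0∞ | ∃ (ω : ℕ → Fin p → ℝ) (x : ℤ → Fin n → ℝ),
    energy ω ≠ 0 ∧ energy ω ≠ ⊤ ∧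
    IsTrajectory A₀ A₁ B K D₀ h₁ h₂ 0 ω x ∧
    (∀ j : ℤ, -(hbar : ℤ) ≤ j → j ≤ 0 → x j = 0) ∧
    r = energy (output L₁ L₂ D K h₁ h₂ x) / energy ω}

end

end DelayHinf

/-!
In the coordinates `ξ = (X₀ Q₃)⁻¹ x` the closed loop, read off from the data, is a descriptor
system with coefficients `X₀ Q₃`, `X₁ Q₃`, `X₁ Q₂`, `X₁ Q₁`, and the form of `Γ` is evaluated at the
column of `ξ(k)`, its delayed values, `ξ(k + 1)`, `-z(k)` and `ω(k)`. Jensen's inequality and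
reciprocal convexity bound the increments of `ξ` over the delay window by the decrease of the double
sum in the Lyapunov–Krasovskii functional `V`, while the descriptor term vanishes up to the
disturbance, so that `V(k + 1) - V(k) ≤ γ |ω(k)|² - |z(k)|² - δ (|x(k)|² + |ω(k)|²)`, where `δ > 0`
because `Γ > 0`. Summation gives the gain bound `γ - δ`. For `ω = 0`, adding a small double window
sum of `|x|²` to `V` makes it contract geometrically.
-/

namespace DelayHinf

section QuadraticForms

variable {ι κ : Type*} [Fintype ι] [Fintype κ]

/-- The quadratic form `v ↦ vᵀ M v` of a square matrix `M`, which need not be symmetric. -/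
def quadForm (M : Matrix ι ι ℝ) (v : ι → ℝ) : ℝ := v ⬝ᵥ M *ᵥ v

lemma dotProduct_self_nonneg (v : ι → ℝ) : 0 ≤ v ⬝ᵥ v := by
  simpa using dotProduct_star_self_nonneg v

lemma mulVec_dotProduct_mulVec_self (M : Matrix κ ι ℝ) (v : ι → ℝ) :
    M *ᵥ v ⬝ᵥ M *ᵥ v = quadForm (Mᵀ * M) v := by
  rw [quadForm, ← mulVec_mulVec, dotProduct_transpose_mulVec]

lemma quadForm_nonneg {M : Matrix ι ι ℝ} (hM : M.PosSemidef) (v : ι → ℝ) : 0 ≤ quadForm M v := by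
  simpa [quadForm] using hM.dotProduct_mulVec_nonneg v

lemma quadForm_add (M N : Matrix ι ι ℝ) (v : ι → ℝ) :
    quadForm (M + N) v = quadForm M v + quadForm N v := by
  simp only [quadForm, add_mulVec, dotProduct_add]

lemma dotProduct_mulVec_comm {M : Matrix ι ι ℝ} (hM : M.IsHermitian) (u v : ι → ℝ) :
    u ⬝ᵥ M *ᵥ v = v ⬝ᵥ M *ᵥ u := by
  rw [← dotProduct_transpose_mulVec, ← conjTranspose_eq_transpose_of_trivial, hM.eq]

lemma exists_mulVec_dotProduct_self_le (M : Matrix κ ι ℝ) :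
    ∃ C : ℝ, 0 < C ∧ ∀ v : ι → ℝ, M *ᵥ v ⬝ᵥ M *ᵥ v ≤ C * (v ⬝ᵥ v) := by
  refine ⟨∑ i, ∑ j, M i j ^ 2 + 1, by positivity, fun v => ?_⟩
  have cauchy_schwarz : M *ᵥ v ⬝ᵥ M *ᵥ v ≤ (∑ i, ∑ j, M i j ^ 2) * (v ⬝ᵥ v) := by
    simp only [dotProduct, mulVec, ← sq, Finset.sum_mul]
    exact Finset.sum_le_sum fun i _ => by
      simpa only [Finset.sum_mul] using Finset.sum_mul_sq_le_sq_mul_sq Finset.univ (M i) v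
  linarith [dotProduct_self_nonneg v]

lemma exists_quadForm_le (M : Matrix ι ι ℝ) :
    ∃ C : ℝ, 0 < C ∧ ∀ v : ι → ℝ, quadForm M v ≤ C * (v ⬝ᵥ v) := by
  obtain ⟨C, hC, hM⟩ := exists_mulVec_dotProduct_self_le M
  refine ⟨(1 + C) / 2, by positivity, fun v => ?_⟩
  have young : 2 * quadForm M v ≤ v ⬝ᵥ v + M *ᵥ v ⬝ᵥ M *ᵥ v := by
    have h := dotProduct_self_nonneg (v - M *ᵥ v)
    rw [sub_dotProduct, dotProduct_sub, dotProduct_sub, dotProduct_comm (M *ᵥ v) v] at h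
    rw [quadForm]
    linarith
  linarith [hM v]

open scoped MatrixOrder in
-- With `M = BᴴB` and `B` invertible, `|v|² = |B⁻¹(Bv)|²` is at most a multiple of `|Bv|² = vᵀMv`.
lemma exists_le_quadForm {M : Matrix ι ι ℝ} (hM : M.PosDef) :
    ∃ δ : ℝ, 0 < δ ∧ ∀ v : ι → ℝ, δ * (v ⬝ᵥ v) ≤ quadForm M v := by
  classical
  obtain ⟨B, rfl⟩ := CStarAlgebra.nonneg_iff_eq_star_mul_self.mp hM.posSemidef.nonneg
  have hB : IsUnit B.det := isUnit_of_mul_isUnit_right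
    (by simpa only [det_mul] using (isUnit_iff_isUnit_det _).1 hM.isUnit)
  obtain ⟨C, hC, hinv⟩ := exists_mulVec_dotProduct_self_le B⁻¹
  refine ⟨C⁻¹, inv_pos.2 hC, fun v => (inv_mul_le_iff₀ hC).2 ?_⟩
  calc v ⬝ᵥ v = B⁻¹ *ᵥ (B *ᵥ v) ⬝ᵥ B⁻¹ *ᵥ (B *ᵥ v) := by
        rw [mulVec_mulVec, nonsing_inv_mul _ hB, one_mulVec]
    _ ≤ C * (B *ᵥ v ⬝ᵥ B *ᵥ v) := hinv _
    _ = C * quadForm (star B * B) v := by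
        rw [mulVec_dotProduct_mulVec_self, star_eq_conjTranspose,
          conjTranspose_eq_transpose_of_trivial]

lemma dotProduct_self_sub_le (u v : ι → ℝ) :
    (u - v) ⬝ᵥ (u - v) ≤ 2 * (u ⬝ᵥ u + v ⬝ᵥ v) := by
  have h := dotProduct_self_nonneg (u + v)
  simp only [dotProduct_add, add_dotProduct, dotProduct_sub, sub_dotProduct] at h ⊢
  linarith

/- Jensen's inequality: expand the nonnegative double sum of the form at `v i - v j`. -/
lemma quadForm_sum_le {R : Matrix ι ι ℝ} (hR : R.PosSemidef) {α : Type*} (s : Finset α)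
    (v : α → ι → ℝ) :
    quadForm R (∑ i ∈ s, v i) ≤ s.card * ∑ i ∈ s, quadForm R (v i) := by
  have hdiff : 0 ≤ ∑ i ∈ s, ∑ j ∈ s, quadForm R (v i - v j) :=
    Finset.sum_nonneg fun i _ => Finset.sum_nonneg fun j _ => quadForm_nonneg hR _
  have hswap : ∑ i ∈ s, ∑ j ∈ s, v j ⬝ᵥ R *ᵥ v i = ∑ i ∈ s, ∑ j ∈ s, v i ⬝ᵥ R *ᵥ v j :=
    Finset.sum_comm
  simp only [quadForm, mulVec_sub, dotProduct_sub, sub_dotProduct, Finset.sum_sub_distrib, hswap,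
    Finset.sum_const, nsmul_eq_mul, ← Finset.mul_sum] at hdiff
  simp only [quadForm, mulVec_sum, dotProduct_sum, sum_dotProduct]
  rw [hswap]
  linarith

end QuadraticForms

section SymBlock

variable {ι κ : Type}

lemma posSemidef_of_symBlock {A : Matrix ι ι ℝ} {B : Matrix ι κ ℝ} {D : Matrix κ κ ℝ}
    (h : (symBlock A B D).PosSemidef) : A.PosSemidef :=
  h.submatrix Sum.inl

variable [Fintype ι] [Fintype κ]

lemma quadForm_symBlock (A : Matrix ι ι ℝ) (B : Matrix ι κ ℝ) (D : Matrix κ κ ℝ)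
    (u : ι → ℝ) (v : κ → ℝ) :
    quadForm (symBlock A B D) (Sum.elim u v)
      = quadForm A u + 2 * (u ⬝ᵥ B *ᵥ v) + quadForm D v := by
  simp only [quadForm, symBlock, fromBlocks_mulVec, sumElim_dotProduct_sumElim,
    Sum.elim_comp_inl, Sum.elim_comp_inr, dotProduct_add, dotProduct_transpose_mulVec]
  ring

/- Reciprocal convexity in Jensen form: the cross terms are controlled by the nonnegative double
sum of the block form at `(u i, -v j)`. -/
lemma quadForm_symBlock_sum_le {R S : Matrix ι ι ℝ} (hRS : (symBlock R S R).PosSemidef)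
    {α β : Type*} (s : Finset α) (t : Finset β) (u : α → ι → ℝ) (v : β → ι → ℝ) :
    quadForm (symBlock R S R) (Sum.elim (∑ i ∈ s, u i) (∑ j ∈ t, v j))
      ≤ (s.card + t.card) * (∑ i ∈ s, quadForm R (u i) + ∑ j ∈ t, quadForm R (v j)) := by
  have hR := posSemidef_of_symBlock hRS
  have hcross : 0 ≤ ∑ i ∈ s, ∑ j ∈ t, quadForm (symBlock R S R) (Sum.elim (u i) (-v j)) :=
    Finset.sum_nonneg fun i _ => Finset.sum_nonneg fun j _ => quadForm_nonneg hRS _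
  have hneg : ∀ j, quadForm R (-v j) = quadForm R (v j) := fun j => by
    simp only [quadForm, mulVec_neg, dotProduct_neg, neg_dotProduct, neg_neg]
  have hbilin : (∑ i ∈ s, u i) ⬝ᵥ S *ᵥ ∑ j ∈ t, v j = ∑ i ∈ s, ∑ j ∈ t, u i ⬝ᵥ S *ᵥ v j := by
    simp only [mulVec_sum, dotProduct_sum, sum_dotProduct]
    exact Finset.sum_comm
  simp only [quadForm_symBlock, hneg, mulVec_neg, dotProduct_neg, Finset.sum_add_distrib,
    Finset.sum_const, nsmul_eq_mul, ← Finset.mul_sum, mul_neg, Finset.sum_neg_distrib] at hcross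
  rw [quadForm_symBlock, hbilin]
  linarith [quadForm_sum_le hR s u, quadForm_sum_le hR t v]

end SymBlock

section WindowSums

/-- The sum of `f` over the window `k - N, …, k - 1`. -/
noncomputable def windowSum (N : ℕ) (f : ℤ → ℝ) (k : ℤ) : ℝ := ∑ j ∈ Finset.Ico (k - N) k, f j

/-- The sum of the window sums of `f` of the lengths `1, …, N`, in which `f (k - i)` has the weight
`N + 1 - i`; it is the double sum of the Lyapunov–Krasovskii functional. -/
noncomputable def doubleWindowSum (N : ℕ) (f : ℤ → ℝ) (k : ℤ) : ℝ :=
  ∑ i ∈ Finset.range N, windowSum (i + 1) f k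

variable {N : ℕ} {f g : ℤ → ℝ} {k : ℤ}

lemma windowSum_succ (N : ℕ) (f : ℤ → ℝ) (k : ℤ) :
    windowSum (N + 1) f k = windowSum N f k + f (k - (N + 1)) := by
  have hIoo : Finset.Ioo (k - (N + 1 : ℕ)) k = Finset.Ico (k - N) k := by
    ext j
    simp only [Finset.mem_Ioo, Finset.mem_Ico]
    omega
  rw [windowSum, windowSum, ← Finset.sum_Ioo_add_eq_sum_Ico (by omega), hIoo, Nat.cast_succ]

lemma windowSum_add_one (N : ℕ) (f : ℤ → ℝ) (k : ℤ) :
    windowSum N f (k + 1) = windowSum N f k + f k - f (k - N) := by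
  have hright : windowSum (N + 1) f (k + 1) = windowSum N f k + f k := by
    rw [windowSum, Nat.cast_succ, add_sub_add_right_eq_sub,
      ← Finset.sum_Ico_add_eq_sum_Ico_add_one (by omega), windowSum]
  have hleft := windowSum_succ N f (k + 1)
  rw [add_sub_add_right_eq_sub] at hleft
  linarith

lemma doubleWindowSum_add_one (N : ℕ) (f : ℤ → ℝ) (k : ℤ) :
    doubleWindowSum N f (k + 1) = doubleWindowSum N f k + N * f k - windowSum N f k := by
  induction N with
  | zero => simp [doubleWindowSum, windowSum]
  | succ N ih =>
    rw [doubleWindowSum, doubleWindowSum, Finset.sum_range_succ, Finset.sum_range_succ,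
      ← doubleWindowSum, ← doubleWindowSum, ih, windowSum_add_one, windowSum_succ]
    push_cast
    ring

lemma windowSum_add (N : ℕ) (f g : ℤ → ℝ) (k : ℤ) :
    windowSum N (fun j => f j + g j) k = windowSum N f k + windowSum N g k :=
  Finset.sum_add_distrib

lemma windowSum_nonneg (hf : ∀ j, 0 ≤ f j) : 0 ≤ windowSum N f k :=
  Finset.sum_nonneg fun j _ => hf j

lemma doubleWindowSum_nonneg (hf : ∀ j, 0 ≤ f j) : 0 ≤ doubleWindowSum N f k :=
  Finset.sum_nonneg fun _ _ => windowSum_nonneg hf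

lemma windowSum_mono (h : ∀ j, k - N ≤ j → j < k → f j ≤ g j) :
    windowSum N f k ≤ windowSum N g k :=
  Finset.sum_le_sum fun j hj => h j (Finset.mem_Ico.1 hj).1 (Finset.mem_Ico.1 hj).2

lemma windowSum_le_mul {C : ℝ} (h : ∀ j, f j ≤ C * g j) :
    windowSum N f k ≤ C * windowSum N g k :=
  (Finset.sum_le_sum fun j _ => h j).trans_eq (Finset.mul_sum _ _ _).symm

lemma windowSum_const (N : ℕ) (c : ℝ) (k : ℤ) : windowSum N (fun _ => c) k = N * c := by
  simp [windowSum]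

lemma doubleWindowSum_le (hf : ∀ j, 0 ≤ f j) :
    doubleWindowSum N f k ≤ N * windowSum N f k := by
  have hlength : ∀ i ∈ Finset.range N, windowSum (i + 1) f k ≤ windowSum N f k := fun i hi =>
    Finset.sum_le_sum_of_subset_of_nonneg
      (Finset.Ico_subset_Ico_left (by have := Finset.mem_range.1 hi; omega)) fun j _ _ => hf j
  simpa [doubleWindowSum] using Finset.sum_le_card_nsmul _ _ _ hlength

lemma le_add_windowSum (hf : ∀ j, 0 ≤ f j) {j : ℤ} (hj : k - N ≤ j) (hjk : j ≤ k) :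
    f j ≤ f k + windowSum N f k := by
  rcases hjk.eq_or_lt with rfl | hlt
  · exact le_add_of_nonneg_right (windowSum_nonneg hf)
  · exact (Finset.single_le_sum (fun i _ => hf i) (Finset.mem_Ico.2 ⟨hj, hlt⟩)).trans
      (le_add_of_nonneg_left (hf k))

lemma sum_Ico_increments {E : Type*} [AddCommGroup E] (x : ℤ → E) {a b : ℤ} (hab : a ≤ b) :
    ∑ j ∈ Finset.Ico a b, (x (j + 1) - x j) = x b - x a := by
  induction b, hab using Int.leInduction with
  | base => simp
  | succ b hab ih => rw [← Finset.sum_Ico_add_eq_sum_Ico_add_one hab, ih]; abel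

end WindowSums

section GeometricDecay

variable {N : ℕ} {C μ : ℝ} {f V : ℤ → ℝ} {k : ℤ}

lemma add_doubleWindowSum_step_le (hstep : V (k + 1) ≤ V k - μ * (N + 1) * f k) :
    V (k + 1) + μ * doubleWindowSum N f (k + 1)
      ≤ V k + μ * doubleWindowSum N f k - μ * (f k + windowSum N f k) := by
  rw [doubleWindowSum_add_one]
  linarith

lemma add_doubleWindowSum_le (hμ : 0 ≤ μ) (hf : ∀ j, 0 ≤ f j)
    (hV : V k ≤ C * (f k + windowSum N f k)) :
    V k + μ * doubleWindowSum N f k ≤ (C + μ * (N + 1)) * (f k + windowSum N f k) := by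
  have hdouble := mul_le_mul_of_nonneg_left (doubleWindowSum_le (N := N) (k := k) hf) hμ
  have hslack : 0 ≤ μ * ((N + 1) * f k + windowSum N f k) :=
    mul_nonneg hμ (add_nonneg (mul_nonneg (by positivity) (hf k)) (windowSum_nonneg hf))
  linarith

lemma add_doubleWindowSum_contracts (hC : 0 < C) (hμ : 0 < μ) (hf : ∀ j, 0 ≤ f j)
    (hV : V k ≤ C * (f k + windowSum N f k)) (hstep : V (k + 1) ≤ V k - μ * (N + 1) * f k) :
    V (k + 1) + μ * doubleWindowSum N f (k + 1)
      ≤ (1 - μ / (C + μ * (N + 1))) * (V k + μ * doubleWindowSum N f k) := by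
  have hE : 0 < C + μ * (N + 1) := by positivity
  have hwindow : μ / (C + μ * (N + 1)) * (V k + μ * doubleWindowSum N f k)
      ≤ μ * (f k + windowSum N f k) := by
    rw [div_mul_eq_mul_div₀, mul_div_assoc]
    gcongr
    exact (div_le_iff₀' hE).2 (add_doubleWindowSum_le hμ.le hf hV)
  linarith [add_doubleWindowSum_step_le hstep]

lemma add_windowSum_le_mul {c : ℝ} (hfc : ∀ j, k - N ≤ j → j ≤ k → f j ≤ c) :
    f k + windowSum N f k ≤ (N + 1) * c := by
  have hwindow : windowSum N f k ≤ N * c :=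
    (windowSum_mono fun j hj hjk => hfc j hj hjk.le).trans (windowSum_const N c k).le
  linarith [hfc k (by omega) le_rfl]

/- A functional decreasing at the rate `δ f` alone need not contract, since `V` may live on past
values of `f`; adding a small double window sum makes it decrease at the rate of the window sum. -/
lemma exists_geometric_decay (N : ℕ) {C δ : ℝ} (hC : 0 < C) (hδ : 0 < δ) :
    ∃ M r : ℝ, 0 < M ∧ 0 < r ∧ r < 1 ∧ ∀ (f V : ℤ → ℝ) (k₀ : ℤ) (c : ℝ),
      (∀ j, 0 ≤ f j) → (∀ k, 0 ≤ V k) → (∀ k, V k ≤ C * (f k + windowSum N f k)) →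
      (∀ k, k₀ ≤ k → V (k + 1) ≤ V k - δ * f k) →
      (∀ j, k₀ - N ≤ j → j ≤ k₀ → f j ≤ c) →
      ∀ i : ℕ, f (k₀ + i) ≤ M * r ^ i * c := by
  obtain ⟨μ, hμ, hμδ⟩ : ∃ μ : ℝ, 0 < μ ∧ μ * (N + 1) = δ :=
    ⟨δ / (N + 1), by positivity, div_mul_cancel₀ _ (by positivity)⟩
  have hμE : μ < C + μ * (N + 1) := by
    linarith [mul_nonneg hμ.le (Nat.cast_nonneg (α := ℝ) N)]
  have hE : 0 < C + μ * (N + 1) := hμ.trans hμE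
  have hr : 0 < 1 - μ / (C + μ * (N + 1)) := sub_pos.2 ((div_lt_one hE).2 hμE)
  refine ⟨(C + μ * (N + 1)) * (N + 1) / μ, 1 - μ / (C + μ * (N + 1)), by positivity, hr,
    sub_lt_self _ (by positivity), fun f V k₀ c hf hV₀ hV hstep hfc i => ?_⟩
  subst hμδ
  let W : ℤ → ℝ := fun k => V k + μ * doubleWindowSum N f k
  have hWnonneg : ∀ k, 0 ≤ W k := fun k =>
    add_nonneg (hV₀ k) (mul_nonneg hμ.le (doubleWindowSum_nonneg hf))
  have hdecay : W (k₀ + i) ≤ (1 - μ / (C + μ * (N + 1))) ^ i * W k₀ := by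
    simpa using le_geom (u := fun j : ℕ => W (k₀ + j)) hr.le i fun j _ => by
      simpa [add_assoc] using
        add_doubleWindowSum_contracts hC hμ hf (hV _) (hstep (k₀ + j) (by omega))
  have hinit : W k₀ ≤ (C + μ * (N + 1)) * ((N + 1) * c) :=
    (add_doubleWindowSum_le hμ.le hf (hV k₀)).trans
      (mul_le_mul_of_nonneg_left (add_windowSum_le_mul hfc) hE.le)
  have hfW : μ * f (k₀ + i) ≤ W (k₀ + i) := by
    have hnext := hWnonneg (k₀ + i + 1)
    have hdecrease := add_doubleWindowSum_step_le (hstep (k₀ + i) (by omega))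
    linarith [mul_nonneg hμ.le (windowSum_nonneg (N := N) (k := k₀ + i) hf)]
  calc f (k₀ + i) ≤ W (k₀ + i) / μ := (le_div_iff₀' hμ).2 hfW
    _ ≤ (1 - μ / (C + μ * (N + 1))) ^ i * ((C + μ * (N + 1)) * ((N + 1) * c)) / μ := by
        gcongr
        exact hdecay.trans (mul_le_mul_of_nonneg_left hinit (pow_nonneg hr.le i))
    _ = _ := by ring

end GeometricDecay

section LyapunovKrasovskii

variable {ι : Type*} [Fintype ι]

/-- The form `R` evaluated at the increment `x (j + 1) - x j`, the summand of the double sum in the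
Lyapunov–Krasovskii functional. -/
def incrementForm (R : Matrix ι ι ℝ) (x : ℤ → ι → ℝ) (j : ℤ) : ℝ := quadForm R (x (j + 1) - x j)

/-- The Lyapunov–Krasovskii functional of the delay system at time `k` along the signal `x`. -/
noncomputable def lyapunov (hbar : ℕ) (P S R : Matrix ι ι ℝ) (x : ℤ → ι → ℝ) (k : ℤ) : ℝ :=
  quadForm P (x k) + windowSum hbar (fun j => quadForm S (x j)) k
    + hbar * doubleWindowSum hbar (incrementForm R x) k

lemma lyapunov_nonneg {P S R : Matrix ι ι ℝ} (hbar : ℕ) (hP : P.PosSemidef) (hS : S.PosSemidef)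
    (hR : R.PosSemidef) (x : ℤ → ι → ℝ) (k : ℤ) : 0 ≤ lyapunov hbar P S R x k :=
  add_nonneg
    (add_nonneg (quadForm_nonneg hP _) (windowSum_nonneg fun _ => quadForm_nonneg hS _))
    (mul_nonneg (Nat.cast_nonneg _) (doubleWindowSum_nonneg fun _ => quadForm_nonneg hR _))

lemma lyapunov_add_one_sub (hbar : ℕ) (P S R : Matrix ι ι ℝ) (x : ℤ → ι → ℝ) (k : ℤ) :
    lyapunov hbar P S R x (k + 1) - lyapunov hbar P S R x k
      = quadForm P (x (k + 1)) - quadForm P (x k) + quadForm S (x k) - quadForm S (x (k - hbar))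
        + hbar ^ 2 * incrementForm R x k - hbar * windowSum hbar (incrementForm R x) k := by
  rw [lyapunov, lyapunov, windowSum_add_one, doubleWindowSum_add_one]
  ring

lemma exists_windowSum_incrementForm_le (hbar : ℕ) (R : Matrix ι ι ℝ) :
    ∃ C : ℝ, 0 < C ∧ ∀ (x : ℤ → ι → ℝ) (k : ℤ), windowSum hbar (incrementForm R x) k
      ≤ C * (x k ⬝ᵥ x k + windowSum hbar (fun j => x j ⬝ᵥ x j) k) := by
  obtain ⟨c, hc, hR⟩ := exists_quadForm_le R
  refine ⟨4 * c * (hbar + 1), by positivity, fun x k => ?_⟩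
  have hle := fun j => le_add_windowSum (N := hbar) (k := k) (j := j)
    fun j => dotProduct_self_nonneg (x j)
  have hsum := (dotProduct_self_nonneg (x k)).trans (hle k (by omega) le_rfl)
  calc windowSum hbar (incrementForm R x) k
      ≤ windowSum hbar
          (fun _ => c * (4 * (x k ⬝ᵥ x k + windowSum hbar (fun j => x j ⬝ᵥ x j) k))) k :=
        windowSum_mono fun j hj hjk => (hR _).trans <| mul_le_mul_of_nonneg_left
          (by linarith [dotProduct_self_sub_le (x (j + 1)) (x j), hle j hj hjk.le,
            hle (j + 1) (by omega) (by omega)]) hc.le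
    _ ≤ 4 * c * (hbar + 1) * (x k ⬝ᵥ x k + windowSum hbar (fun j => x j ⬝ᵥ x j) k) := by
        rw [windowSum_const]
        linarith [mul_nonneg hc.le hsum]

lemma exists_lyapunov_le (hbar : ℕ) (P S : Matrix ι ι ℝ) {R : Matrix ι ι ℝ}
    (hR : R.PosSemidef) :
    ∃ C : ℝ, 0 < C ∧ ∀ (x : ℤ → ι → ℝ) (k : ℤ), lyapunov hbar P S R x k
      ≤ C * (x k ⬝ᵥ x k + windowSum hbar (fun j => x j ⬝ᵥ x j) k) := by
  obtain ⟨a, ha, hPle⟩ := exists_quadForm_le P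
  obtain ⟨b, hb, hSle⟩ := exists_quadForm_le S
  obtain ⟨c, hc, hRle⟩ := exists_windowSum_incrementForm_le hbar R
  refine ⟨a + b + hbar ^ 2 * c, by positivity, fun x k => ?_⟩
  have hstate := dotProduct_self_nonneg (x k)
  have hwindow : 0 ≤ windowSum hbar (fun j => x j ⬝ᵥ x j) k :=
    windowSum_nonneg fun j => dotProduct_self_nonneg (x j)
  have hdouble : hbar * doubleWindowSum hbar (incrementForm R x) k
      ≤ hbar * (hbar * (c * (x k ⬝ᵥ x k + windowSum hbar (fun j => x j ⬝ᵥ x j) k))) := by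
    gcongr
    exact (doubleWindowSum_le fun j => quadForm_nonneg hR _).trans
      (mul_le_mul_of_nonneg_left (hRle x k) (Nat.cast_nonneg _))
  have hSwindow : windowSum hbar (fun j => quadForm S (x j)) k
      ≤ b * windowSum hbar (fun j => x j ⬝ᵥ x j) k := windowSum_le_mul fun j => hSle (x j)
  rw [lyapunov]
  linarith [hPle (x k), mul_nonneg hb.le hstate, mul_nonneg ha.le hwindow]

lemma quadForm_delayed_le {ι : Type} [Fintype ι] {R S : Matrix ι ι ℝ}
    (hRS : (symBlock R S R).PosSemidef) {hbar τ : ℕ} (hτ : τ ≤ hbar) (x : ℤ → ι → ℝ) (k : ℤ) :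
    quadForm (symBlock R S R) (Sum.elim (x k - x (k - τ)) (x (k - τ) - x (k - hbar)))
      ≤ hbar * windowSum hbar (incrementForm R x) k := by
  have h := quadForm_symBlock_sum_le hRS (Finset.Ico (k - τ) k) (Finset.Ico (k - hbar) (k - τ))
    (fun j => x (j + 1) - x j) (fun j => x (j + 1) - x j)
  have hcard : ((Finset.Ico (k - τ) k).card : ℝ) + (Finset.Ico (k - hbar) (k - τ)).card = hbar := by
    rw [Int.card_Ico, Int.card_Ico]
    norm_cast
    omega
  rwa [sum_Ico_increments x (by omega), sum_Ico_increments x (by omega), hcard,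
    add_comm (Finset.sum _ _), ← Finset.sum_union (Finset.Ico_disjoint_Ico_consecutive _ _ _),
    Finset.Ico_union_Ico_eq_Ico (by omega) (by omega)] at h

end LyapunovKrasovskii

section MatrixInequality

variable {n m p q T : ℕ}

/-- A column of five blocks, to which a `row5` is applied block by block. -/
def col5 (v₁ v₂ v₃ v₄ v₅ : Fin n → ℝ) : Five n → ℝ :=
  Sum.elim v₁ (Sum.elim v₂ (Sum.elim v₃ (Sum.elim v₄ v₅)))

lemma row5_mulVec_col5 {ι : Type} (M₁ M₂ M₃ M₄ M₅ : Matrix ι (Fin n) ℝ)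
    (v₁ v₂ v₃ v₄ v₅ : Fin n → ℝ) :
    row5 M₁ M₂ M₃ M₄ M₅ *ᵥ col5 v₁ v₂ v₃ v₄ v₅
      = M₁ *ᵥ v₁ + M₂ *ᵥ v₂ + M₃ *ᵥ v₃ + M₄ *ᵥ v₄ + M₅ *ᵥ v₅ := by
  simp only [row5, col5, fromCols_mulVec_sumElim, add_assoc]

lemma dotProduct_self_le_col5 (v₁ v₂ v₃ v₄ v₅ : Fin n → ℝ) :
    v₁ ⬝ᵥ v₁ ≤ col5 v₁ v₂ v₃ v₄ v₅ ⬝ᵥ col5 v₁ v₂ v₃ v₄ v₅ := by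
  simp only [col5, sumElim_dotProduct_sumElim]
  linarith [dotProduct_self_nonneg v₂, dotProduct_self_nonneg v₃, dotProduct_self_nonneg v₄,
    dotProduct_self_nonneg v₅]

/- With `y` standing for the successor of `x`, `a` and `b` for its delayed values and `c` for the
value at the far end of the window, the last summand is the descriptor term, which vanishes along
the undisturbed system. -/
lemma quadForm_PhiBar (hbar : ℕ) (ε : ℝ) (X₀ X₁ : Matrix (Fin n) (Fin T) ℝ)
    (P S S₁ S₂ : Matrix (Fin n) (Fin n) ℝ) {R₁ R₂ : Matrix (Fin n) (Fin n) ℝ}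
    (Q₁ Q₂ Q₃ : Matrix (Fin T) (Fin n) ℝ) (hR₁ : R₁.IsHermitian) (hR₂ : R₂.IsHermitian)
    (x a b c y : Fin n → ℝ) :
    quadForm (PhiBar hbar ε X₀ X₁ P S R₁ R₂ S₁ S₂ Q₁ Q₂ Q₃) (col5 x a b c y)
      = quadForm P x - quadForm P y - quadForm S x + quadForm S c
        - hbar ^ 2 * quadForm (R₁ + R₂) (y - x)
        + quadForm (symBlock R₁ S₁ R₁) (Sum.elim (x - a) (a - c))
        + quadForm (symBlock R₂ S₂ R₂) (Sum.elim (x - b) (b - c))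
        + 2 * ((x + ε • y) ⬝ᵥ ((X₀ * Q₃) *ᵥ y
          - ((X₁ * Q₃) *ᵥ x + (X₁ * Q₂) *ᵥ a + (X₁ * Q₁) *ᵥ b))) := by
  simp only [PhiBar, ← transpose_mul, col5, quadForm_symBlock]
  simp only [quadForm, fromCols_mulVec_sumElim, add_mulVec, sub_mulVec, neg_mulVec, smul_mulVec,
    zero_mulVec, dotProduct_add, dotProduct_sub, dotProduct_neg, dotProduct_smul, smul_eq_mul,
    dotProduct_zero, add_dotProduct, smul_dotProduct, dotProduct_transpose_mulVec, mulVec_sub,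
    sub_dotProduct]
  rw [dotProduct_mulVec_comm hR₁ x a, dotProduct_mulVec_comm hR₁ x y,
    dotProduct_mulVec_comm hR₁ a c, dotProduct_mulVec_comm hR₂ x b,
    dotProduct_mulVec_comm hR₂ x y, dotProduct_mulVec_comm hR₂ b c]
  ring

lemma quadForm_GammaBar (γ ε : ℝ) (Φ : Matrix (Five n) (Five n) ℝ)
    (κ : Matrix (Fin q) (Five n) ℝ) (D₀ : Matrix (Fin n) (Fin p) ℝ) (x a b c y : Fin n → ℝ)
    (w : Fin p → ℝ) :
    quadForm (GammaBar γ (PsiBar Φ κ) (kappa₂ q ε D₀))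
        (Sum.elim (Sum.elim (col5 x a b c y) (-(κ *ᵥ col5 x a b c y))) w)
      = quadForm Φ (col5 x a b c y) - κ *ᵥ col5 x a b c y ⬝ᵥ κ *ᵥ col5 x a b c y
        - 2 * ((x + ε • y) ⬝ᵥ D₀ *ᵥ w) + γ * (w ⬝ᵥ w) := by
  simp only [GammaBar, PsiBar, kappa₂, quadForm_symBlock, dotProduct_transpose_mulVec,
    fromCols_mulVec_sumElim, row5_mulVec_col5]
  simp only [quadForm, neg_mulVec, smul_mulVec, zero_mulVec, one_mulVec, dotProduct_add,
    dotProduct_neg, dotProduct_smul, smul_eq_mul, dotProduct_zero, neg_dotProduct, add_dotProduct,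
    smul_dotProduct, dotProduct_transpose_mulVec]
  ring

lemma isUnit_of_posDef_PhiBar {hbar : ℕ} {ε : ℝ} {X₀ X₁ : Matrix (Fin n) (Fin T) ℝ}
    {P S R₁ R₂ S₁ S₂ : Matrix (Fin n) (Fin n) ℝ} {Q₁ Q₂ Q₃ : Matrix (Fin T) (Fin n) ℝ}
    (hP : P.PosSemidef) (hR₁ : R₁.PosSemidef) (hR₂ : R₂.PosSemidef)
    (hΦ : (PhiBar hbar ε X₀ X₁ P S R₁ R₂ S₁ S₂ Q₁ Q₂ Q₃).PosDef) : IsUnit (X₀ * Q₃) := by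
  rw [← mulVec_injective_iff_isUnit, ← coe_mulVecLin, injective_iff_map_eq_zero]
  intro v hv
  rw [mulVecLin_apply] at hv
  obtain ⟨δ, hδ, hle⟩ := exists_le_quadForm hΦ
  have hcorner := hle (col5 0 0 0 0 v)
  have hself : v ⬝ᵥ v ≤ col5 0 0 0 0 v ⬝ᵥ col5 0 0 0 0 v := by
    simp only [col5, sumElim_dotProduct_sumElim, zero_dotProduct, zero_add, le_refl]
  have hneg : quadForm (PhiBar hbar ε X₀ X₁ P S R₁ R₂ S₁ S₂ Q₁ Q₂ Q₃) (col5 0 0 0 0 v)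
      = -quadForm P v - hbar ^ 2 * quadForm (R₁ + R₂) v := by
    rw [quadForm_PhiBar _ _ _ _ _ _ _ _ _ _ _ hR₁.isHermitian hR₂.isHermitian, hv,
      quadForm_symBlock, quadForm_symBlock]
    simp only [quadForm, sub_self, sub_zero, mulVec_zero, add_zero, dotProduct_zero, mul_zero,
      zero_sub]
  have hRv := mul_nonneg (sq_nonneg (hbar : ℝ)) (quadForm_nonneg (hR₁.add hR₂) v)
  have hδv : δ * (v ⬝ᵥ v) ≤ 0 := by
    linarith [mul_le_mul_of_nonneg_left hself hδ.le, quadForm_nonneg hP v]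
  exact dotProduct_self_eq_zero.1
    ((nonpos_of_mul_nonpos_right hδv hδ).antisymm (dotProduct_self_nonneg v))

lemma lyapunov_step_le {hbar : ℕ} (γ : ℝ) {ε : ℝ} {X₀ X₁ : Matrix (Fin n) (Fin T) ℝ}
    {P S R₁ R₂ S₁ S₂ : Matrix (Fin n) (Fin n) ℝ} {Q₁ Q₂ Q₃ : Matrix (Fin T) (Fin n) ℝ}
    (κ : Matrix (Fin q) (Five n) ℝ) {D₀ : Matrix (Fin n) (Fin p) ℝ}
    (hRS₁ : (symBlock R₁ S₁ R₁).PosSemidef) (hRS₂ : (symBlock R₂ S₂ R₂).PosSemidef)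
    {τ₁ τ₂ : ℕ} (hτ₁ : τ₁ ≤ hbar) (hτ₂ : τ₂ ≤ hbar) {x : ℤ → Fin n → ℝ} {k : ℤ} {w : Fin p → ℝ}
    (hx : (X₀ * Q₃) *ᵥ x (k + 1) = (X₁ * Q₃) *ᵥ x k + (X₁ * Q₂) *ᵥ x (k - τ₁)
      + (X₁ * Q₁) *ᵥ x (k - τ₂) + D₀ *ᵥ w)
    {ξ : Five n → ℝ}
    (hξ : ξ = col5 (x k) (x (k - τ₁)) (x (k - τ₂)) (x (k - hbar)) (x (k + 1))) :
    lyapunov hbar P S (R₁ + R₂) x (k + 1) - lyapunov hbar P S (R₁ + R₂) x k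
      ≤ γ * (w ⬝ᵥ w) - κ *ᵥ ξ ⬝ᵥ κ *ᵥ ξ
        - quadForm (GammaBar γ
            (PsiBar (PhiBar hbar ε X₀ X₁ P S R₁ R₂ S₁ S₂ Q₁ Q₂ Q₃) κ) (kappa₂ q ε D₀))
          (Sum.elim (Sum.elim ξ (-(κ *ᵥ ξ))) w) := by
  have hR₁ := (posSemidef_of_symBlock hRS₁).isHermitian
  have hR₂ := (posSemidef_of_symBlock hRS₂).isHermitian
  have hwindow : windowSum hbar (incrementForm (R₁ + R₂) x) k
      = windowSum hbar (incrementForm R₁ x) k + windowSum hbar (incrementForm R₂ x) k := by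
    rw [← windowSum_add]
    exact congrArg (windowSum hbar · k) (funext fun j => quadForm_add R₁ R₂ _)
  have hdescriptor : (X₀ * Q₃) *ᵥ x (k + 1) - ((X₁ * Q₃) *ᵥ x k + (X₁ * Q₂) *ᵥ x (k - τ₁)
      + (X₁ * Q₁) *ᵥ x (k - τ₂)) = D₀ *ᵥ w := by
    rw [hx, add_sub_cancel_left]
  rw [hξ, quadForm_GammaBar, quadForm_PhiBar _ _ _ _ _ _ _ _ _ _ _ hR₁ hR₂, hdescriptor,
    lyapunov_add_one_sub, hwindow, incrementForm]
  linarith [quadForm_delayed_le hRS₁ hτ₁ x k, quadForm_delayed_le hRS₂ hτ₂ x k]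

lemma posDef_PhiBar_of_GammaBar {γ : ℝ} {Φ : Matrix (Five n) (Five n) ℝ}
    {κ : Matrix (Fin q) (Five n) ℝ} {κ₂ : Matrix (Fin p) (Five n ⊕ Fin q) ℝ}
    (h : (GammaBar γ (PsiBar Φ κ) κ₂).PosDef) : Φ.PosDef :=
  h.submatrix (Sum.inl_injective.comp Sum.inl_injective)

lemma exists_lyapunov_dissipation {hbar : ℕ} {γ ε : ℝ} {X₀ X₁ : Matrix (Fin n) (Fin T) ℝ}
    {P S R₁ R₂ S₁ S₂ : Matrix (Fin n) (Fin n) ℝ} {Q₁ Q₂ Q₃ : Matrix (Fin T) (Fin n) ℝ}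
    {M₁ M₂ M₃ : Matrix (Fin q) (Fin n) ℝ} {D₀ : Matrix (Fin n) (Fin p) ℝ}
    (hRS₁ : (symBlock R₁ S₁ R₁).PosSemidef) (hRS₂ : (symBlock R₂ S₂ R₂).PosSemidef)
    (hΓ : (GammaBar γ (PsiBar (PhiBar hbar ε X₀ X₁ P S R₁ R₂ S₁ S₂ Q₁ Q₂ Q₃)
      (row5 M₁ M₂ M₃ 0 0)) (kappa₂ q ε D₀)).PosDef) :
    ∃ δ : ℝ, 0 < δ ∧ ∀ (τ₁ τ₂ : ℕ), τ₁ ≤ hbar → τ₂ ≤ hbar →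
      ∀ (x : ℤ → Fin n → ℝ) (k : ℤ) (w : Fin p → ℝ) (z : Fin q → ℝ),
      (X₀ * Q₃) *ᵥ x (k + 1) = (X₁ * Q₃) *ᵥ x k + (X₁ * Q₂) *ᵥ x (k - τ₁)
        + (X₁ * Q₁) *ᵥ x (k - τ₂) + D₀ *ᵥ w →
      z = M₁ *ᵥ x k + M₂ *ᵥ x (k - τ₁) + M₃ *ᵥ x (k - τ₂) →
      lyapunov hbar P S (R₁ + R₂) x (k + 1) - lyapunov hbar P S (R₁ + R₂) x k
        ≤ γ * (w ⬝ᵥ w) - z ⬝ᵥ z - δ * (x k ⬝ᵥ x k + w ⬝ᵥ w) := by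
  obtain ⟨δ, hδ, hle⟩ := exists_le_quadForm hΓ
  refine ⟨δ, hδ, fun τ₁ τ₂ hτ₁ hτ₂ x k w z hx hz => ?_⟩
  obtain ⟨ξ, hξ⟩ : ∃ ξ, ξ = col5 (x k) (x (k - τ₁)) (x (k - τ₂)) (x (k - hbar)) (x (k + 1)) :=
    ⟨_, rfl⟩
  have hstep := lyapunov_step_le (P := P) (S := S) (ε := ε) γ (row5 M₁ M₂ M₃ 0 0) hRS₁ hRS₂
    hτ₁ hτ₂ hx hξ
  have hκξ : row5 M₁ M₂ M₃ 0 0 *ᵥ ξ = z := by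
    rw [hξ, row5_mulVec_col5, hz, zero_mulVec, zero_mulVec, add_zero, add_zero]
  have hstrict := hle (Sum.elim (Sum.elim ξ (-(row5 M₁ M₂ M₃ 0 0 *ᵥ ξ))) w)
  have hnorm : x k ⬝ᵥ x k + w ⬝ᵥ w
      ≤ Sum.elim (Sum.elim ξ (-z)) w ⬝ᵥ Sum.elim (Sum.elim ξ (-z)) w := by
    rw [hξ, sumElim_dotProduct_sumElim, sumElim_dotProduct_sumElim]
    linarith [dotProduct_self_le_col5 (x k) (x (k - τ₁)) (x (k - τ₂)) (x (k - hbar)) (x (k + 1)),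
      dotProduct_self_nonneg (-z)]
  rw [hκξ] at hstep hstrict
  linarith [mul_le_mul_of_nonneg_left hnorm hδ.le]

end MatrixInequality

section Dissipativity

variable {n m p q : ℕ} {A₀ A₁ : Matrix (Fin n) (Fin n) ℝ} {B : Matrix (Fin n) (Fin m) ℝ}
  {K : Matrix (Fin m) (Fin n) ℝ} {D₀ : Matrix (Fin n) (Fin p) ℝ} {L₁ L₂ : Matrix (Fin q) (Fin n) ℝ}
  {D : Matrix (Fin q) (Fin m) ℝ} {hbar : ℕ} {h₁ h₂ : ℕ → ℕ} {γ : ℝ}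
  {V : (ℤ → Fin n → ℝ) → ℤ → ℝ}

/-- `V` is a storage functional certifying strict dissipativity of the closed loop with respect to
the supply rate `γ ‖ω‖² - ‖z‖²`. It may depend on the history of the state over the delay window,
by which it is bounded quadratically, and so it takes a whole signal and a time. -/
structure IsStrictStorage (A₀ A₁ : Matrix (Fin n) (Fin n) ℝ) (B : Matrix (Fin n) (Fin m) ℝ)
    (K : Matrix (Fin m) (Fin n) ℝ) (D₀ : Matrix (Fin n) (Fin p) ℝ)
    (L₁ L₂ : Matrix (Fin q) (Fin n) ℝ) (D : Matrix (Fin q) (Fin m) ℝ) (hbar : ℕ) (h₁ h₂ : ℕ → ℕ)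
    (γ : ℝ) (V : (ℤ → Fin n → ℝ) → ℤ → ℝ) : Prop where
  nonneg : ∀ x k, 0 ≤ V x k
  le_window : ∃ C : ℝ, 0 < C ∧ ∀ x k,
    V x k ≤ C * (x k ⬝ᵥ x k + windowSum hbar (fun j => x j ⬝ᵥ x j) k)
  dissipation : ∃ δ : ℝ, 0 < δ ∧ ∀ (k₀ : ℕ) (ω : ℕ → Fin p → ℝ) (x : ℤ → Fin n → ℝ),
    IsTrajectory A₀ A₁ B K D₀ h₁ h₂ k₀ ω x → ∀ k : ℕ, k₀ ≤ k →
      V x (k + 1) - V x k ≤ γ * (ω k ⬝ᵥ ω k)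
        - output L₁ L₂ D K h₁ h₂ x k ⬝ᵥ output L₁ L₂ D K h₁ h₂ x k
        - δ * (x k ⬝ᵥ x k + ω k ⬝ᵥ ω k)

lemma IsStrictStorage.isExpStable
    (hV : IsStrictStorage A₀ A₁ B K D₀ L₁ L₂ D hbar h₁ h₂ γ V) :
    IsExpStable A₀ A₁ B K D₀ hbar h₁ h₂ := by
  obtain ⟨C, hC, hVle⟩ := hV.le_window
  obtain ⟨δ, hδ, hdiss⟩ := hV.dissipation
  obtain ⟨M, r, hM, hr₀, hr₁, hdecay⟩ := exists_geometric_decay hbar hC hδ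
  refine ⟨√M, √r, Real.sqrt_pos.2 hM, Real.sqrt_pos.2 hr₀,
    Real.sqrt_one ▸ Real.sqrt_lt_sqrt hr₀.le hr₁, fun k₀ x hx c hc i => ?_⟩
  have hc₀ : 0 ≤ c := (Real.sqrt_nonneg _).trans (hc k₀ (by omega) le_rfl)
  have hdecrease : ∀ k : ℤ, k₀ ≤ k → V x (k + 1) ≤ V x k - δ * (x k ⬝ᵥ x k) := fun k hk => by
    lift k to ℕ using (Int.natCast_nonneg k₀).trans hk
    have hstep := hdiss k₀ _ x hx k (by exact_mod_cast hk)
    simp only [dotProduct_zero, mul_zero, add_zero, zero_sub] at hstep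
    linarith [dotProduct_self_nonneg (output L₁ L₂ D K h₁ h₂ x k)]
  have hsq : x (k₀ + i) ⬝ᵥ x (k₀ + i) ≤ M * r ^ i * c ^ 2 :=
    hdecay (fun j => x j ⬝ᵥ x j) (V x) k₀ (c ^ 2) (fun j => dotProduct_self_nonneg _)
      (hV.nonneg x) (hVle x) hdecrease (fun j hj hjk => (Real.sqrt_le_iff.1 (hc j hj hjk)).2) i
  refine Real.sqrt_le_iff.2 ⟨by positivity, hsq.trans_eq ?_⟩
  rw [mul_pow, mul_pow, Real.sq_sqrt hM.le, pow_right_comm, Real.sq_sqrt hr₀.le]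

lemma energy_le_of_sum_le {g : ℝ} (hg : 0 ≤ g) {z : ℕ → Fin q → ℝ} {w : ℕ → Fin p → ℝ}
    (h : ∀ N, ∑ k ∈ Finset.range N, z k ⬝ᵥ z k ≤ g * ∑ k ∈ Finset.range N, w k ⬝ᵥ w k) :
    energy z ≤ ENNReal.ofReal g * energy w := by
  refine ENNReal.tsum_le_of_sum_range_le fun N => ?_
  calc ∑ k ∈ Finset.range N, ENNReal.ofReal (z k ⬝ᵥ z k)
      = ENNReal.ofReal (∑ k ∈ Finset.range N, z k ⬝ᵥ z k) :=
        (ENNReal.ofReal_sum_of_nonneg fun _ _ => dotProduct_self_nonneg _).symm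
    _ ≤ ENNReal.ofReal (g * ∑ k ∈ Finset.range N, w k ⬝ᵥ w k) := ENNReal.ofReal_le_ofReal (h N)
    _ = ENNReal.ofReal g * ∑ k ∈ Finset.range N, ENNReal.ofReal (w k ⬝ᵥ w k) := by
        rw [ENNReal.ofReal_mul hg, ENNReal.ofReal_sum_of_nonneg fun _ _ => dotProduct_self_nonneg _]
    _ ≤ ENNReal.ofReal g * energy w := by
        gcongr
        exact ENNReal.sum_le_tsum _

lemma sum_le_mul_sum_of_step {V f g : ℕ → ℝ} {c : ℝ} (hV : ∀ k, 0 ≤ V k) (hV₀ : V 0 ≤ 0)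
    (hstep : ∀ k, V (k + 1) - V k ≤ c * g k - f k) (N : ℕ) :
    ∑ k ∈ Finset.range N, f k ≤ c * ∑ k ∈ Finset.range N, g k := by
  have htelescope := Finset.sum_le_sum fun k (_ : k ∈ Finset.range N) => hstep k
  rw [Finset.sum_range_sub, Finset.sum_sub_distrib, ← Finset.mul_sum] at htelescope
  linarith [hV N]

lemma IsStrictStorage.l2Gain_lt
    (hV : IsStrictStorage A₀ A₁ B K D₀ L₁ L₂ D hbar h₁ h₂ γ V) (hγ : 0 < γ) :
    l2Gain A₀ A₁ B K D₀ L₁ L₂ D hbar h₁ h₂ < ENNReal.ofReal γ := by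
  obtain ⟨C, hC, hVle⟩ := hV.le_window
  obtain ⟨δ, hδ, hdiss⟩ := hV.dissipation
  refine lt_of_le_of_lt (b := ENNReal.ofReal (max (γ - δ) 0)) (sSup_le ?_)
    ((ENNReal.ofReal_lt_ofReal_iff hγ).2 (max_lt (sub_lt_self γ hδ) hγ))
  rintro _ ⟨ω, x, -, -, hx, hx₀, rfl⟩
  have hhistory : x 0 ⬝ᵥ x 0 + windowSum hbar (fun j => x j ⬝ᵥ x j) 0 ≤ (hbar + 1) * 0 :=
    add_windowSum_le_mul (f := fun j => x j ⬝ᵥ x j) fun j hj hj₀ => by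
      rw [hx₀ j (by omega) hj₀, dotProduct_zero]
  have hinit : V x 0 ≤ 0 := (hVle x 0).trans <|
    mul_nonpos_of_nonneg_of_nonpos hC.le (hhistory.trans_eq (mul_zero _))
  refine ENNReal.div_le_of_le_mul (energy_le_of_sum_le (le_max_right _ _)
    (sum_le_mul_sum_of_step (V := fun k => V x k) (fun k => hV.nonneg x k) hinit fun k => ?_))
  have hstep := hdiss 0 ω x hx k (Nat.zero_le k)
  have hmax := mul_le_mul_of_nonneg_right (le_max_left (γ - δ) 0) (dotProduct_self_nonneg (ω k))
  push_cast
  linarith [mul_nonneg hδ.le (dotProduct_self_nonneg (x k))]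

end Dissipativity

section DataBasedDesign

variable {n m p q T : ℕ} {A₀ A₁ : Matrix (Fin n) (Fin n) ℝ} {B : Matrix (Fin n) (Fin m) ℝ}

lemma IsRecordedData.dataMatrix_eq {d₁ d₂ : ℕ} {ud : ℤ → Fin m → ℝ} {xd : ℤ → Fin n → ℝ}
    (hdata : IsRecordedData A₀ A₁ B d₁ d₂ T ud xd) :
    dataMatrix xd 1 T = A₀ * dataMatrix xd 0 T + A₁ * dataMatrix (delayed xd d₁) 0 T
      + B * dataMatrix (delayed ud d₂) 0 T := by
  ext r c
  have hcolumn := congrFun (hdata c c.2) r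
  rw [add_comm (c : ℤ)] at hcolumn
  simpa [dataMatrix, mul_apply, mulVec, dotProduct] using hcolumn

/- The change of coordinates `ξ = (X₀ Q₃)⁻¹ x` turns the trajectories of the closed loop into those
of the descriptor system in the matrix inequality. -/
lemma exists_isStrictStorage {K : Matrix (Fin m) (Fin n) ℝ} {D₀ : Matrix (Fin n) (Fin p) ℝ}
    {L₁ L₂ : Matrix (Fin q) (Fin n) ℝ} {D : Matrix (Fin q) (Fin m) ℝ} {hbar : ℕ} {h₁ h₂ : ℕ → ℕ}
    (hh₁ : ∀ k, h₁ k ≤ hbar) (hh₂ : ∀ k, h₂ k ≤ hbar) {γ ε : ℝ}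
    {U : Matrix (Fin m) (Fin T) ℝ} {X₀ X₁ : Matrix (Fin n) (Fin T) ℝ}
    {P S R₁ R₂ S₁ S₂ : Matrix (Fin n) (Fin n) ℝ} {Q₁ Q₂ Q₃ : Matrix (Fin T) (Fin n) ℝ}
    (hP : P.PosSemidef) (hS : S.PosSemidef)
    (hΓ : (GammaBar γ (PsiBar (PhiBar hbar ε X₀ X₁ P S R₁ R₂ S₁ S₂ Q₁ Q₂ Q₃)
      (kappa L₁ L₂ D U X₀ Q₁ Q₃)) (kappa₂ q ε D₀)).PosDef)
    (hRS₁ : (symBlock R₁ S₁ R₁).PosSemidef) (hRS₂ : (symBlock R₂ S₂ R₂).PosSemidef)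
    (hY : IsUnit (X₀ * Q₃)) (hX₁Q₃ : X₁ * Q₃ = A₀ * (X₀ * Q₃)) (hX₁Q₂ : X₁ * Q₂ = A₁ * (X₀ * Q₃))
    (hX₁Q₁ : X₁ * Q₁ = B * K * (X₀ * Q₃)) (hUQ₁ : U * Q₁ = K * (X₀ * Q₃)) :
    ∃ V, IsStrictStorage A₀ A₁ B K D₀ L₁ L₂ D hbar h₁ h₂ γ V := by
  have hR := (posSemidef_of_symBlock hRS₁).add (posSemidef_of_symBlock hRS₂)
  have hYZ : ∀ v : Fin n → ℝ, (X₀ * Q₃) *ᵥ ((X₀ * Q₃)⁻¹ *ᵥ v) = v := fun v => by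
    rw [mulVec_mulVec, mul_nonsing_inv _ ((isUnit_iff_isUnit_det _).1 hY), one_mulVec]
  have hDUQ₁ : D * U * Q₁ = D * K * (X₀ * Q₃) := by
    rw [Matrix.mul_assoc, hUQ₁, Matrix.mul_assoc]
  refine ⟨fun x => lyapunov hbar P S (R₁ + R₂) fun j => (X₀ * Q₃)⁻¹ *ᵥ x j,
    fun x k => lyapunov_nonneg hbar hP hS hR _ k, ?_, ?_⟩
  · obtain ⟨C, hC, hVle⟩ := exists_lyapunov_le hbar P S hR
    obtain ⟨a, ha, hZ⟩ := exists_mulVec_dotProduct_self_le (X₀ * Q₃)⁻¹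
    refine ⟨C * a, by positivity, fun x k => (hVle _ k).trans ?_⟩
    rw [mul_assoc, mul_add a]
    exact mul_le_mul_of_nonneg_left
      (add_le_add (hZ (x k)) (windowSum_le_mul fun j => hZ (x j))) hC.le
  · obtain ⟨δ, hδ, hdiss⟩ := exists_lyapunov_dissipation hRS₁ hRS₂ hΓ
    obtain ⟨b, hb, hYle⟩ := exists_mulVec_dotProduct_self_le (X₀ * Q₃)
    refine ⟨δ / (b + 1), by positivity, fun k₀ ω x hx k hk => ?_⟩
    have hstep := hdiss (h₁ k) (h₂ k) (hh₁ k) (hh₂ k) (fun j => (X₀ * Q₃)⁻¹ *ᵥ x j) k (ω k)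
      (output L₁ L₂ D K h₁ h₂ x k)
      (by simpa only [hX₁Q₃, hX₁Q₂, hX₁Q₁, ← mulVec_mulVec _ _ (X₀ * Q₃), hYZ] using hx k hk)
      (by simp only [Matrix.mul_assoc L₁, Matrix.mul_assoc L₂, hDUQ₁,
          ← mulVec_mulVec _ _ (X₀ * Q₃), hYZ, output])
    refine hstep.trans (sub_le_sub_left ?_ _)
    rw [div_mul_eq_mul_div, div_le_iff₀ (by positivity), mul_assoc]
    gcongr
    have hx_le := hYle ((X₀ * Q₃)⁻¹ *ᵥ x k)
    rw [hYZ] at hx_le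
    linarith [mul_nonneg hb.le (dotProduct_self_nonneg (ω k)),
      dotProduct_self_nonneg ((X₀ * Q₃)⁻¹ *ᵥ x k)]

end DataBasedDesign

end DelayHinf

theorem corollary2_general {n m p q T hbar : ℕ}
    {A₀ A₁ : Matrix (Fin n) (Fin n) ℝ} {B : Matrix (Fin n) (Fin m) ℝ}
    {D₀ : Matrix (Fin n) (Fin p) ℝ} {L₁ L₂ : Matrix (Fin q) (Fin n) ℝ}
    {D : Matrix (Fin q) (Fin m) ℝ} {U : Matrix (Fin m) (Fin T) ℝ}
    {Xh X₀ X₁ : Matrix (Fin n) (Fin T) ℝ} (hX : X₁ = A₀ * X₀ + A₁ * Xh + B * U)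
    {γ ε : ℝ} (hγ : 0 < γ) {P S R₁ R₂ S₁ S₂ : Matrix (Fin n) (Fin n) ℝ}
    {Q₁ Q₂ Q₃ : Matrix (Fin T) (Fin n) ℝ} (hP : P.PosSemidef) (hS : S.PosSemidef)
    (hΓ : (DelayHinf.GammaBar γ
      (DelayHinf.PsiBar (DelayHinf.PhiBar hbar ε X₀ X₁ P S R₁ R₂ S₁ S₂ Q₁ Q₂ Q₃)
        (DelayHinf.kappa L₁ L₂ D U X₀ Q₁ Q₃))
      (DelayHinf.kappa₂ q ε D₀)).PosDef)
    (hRS₁ : (DelayHinf.symBlock R₁ S₁ R₁).PosSemidef)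
    (hRS₂ : (DelayHinf.symBlock R₂ S₂ R₂).PosSemidef)
    (hUQ₂ : U * Q₂ = 0) (hUQ₃ : U * Q₃ = 0) (hXhQ₁ : Xh * Q₁ = 0) (hXhQ₃ : Xh * Q₃ = 0)
    (hX₀Q₁ : X₀ * Q₁ = 0) (hX₀Q₂ : X₀ * Q₂ = 0) (hXhQ₂ : Xh * Q₂ = X₀ * Q₃)
    {K : Matrix (Fin m) (Fin n) ℝ} (hK : K = U * Q₁ * (X₀ * Q₃)⁻¹) {h₁ h₂ : ℕ → ℕ}
    (hh₁ : ∀ k, h₁ k ≤ hbar) (hh₂ : ∀ k, h₂ k ≤ hbar) :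
    DelayHinf.IsExpStable A₀ A₁ B K D₀ hbar h₁ h₂ ∧
      DelayHinf.l2Gain A₀ A₁ B K D₀ L₁ L₂ D hbar h₁ h₂ < ENNReal.ofReal γ := by
  have hY : IsUnit (X₀ * Q₃) :=
    DelayHinf.isUnit_of_posDef_PhiBar hP (DelayHinf.posSemidef_of_symBlock hRS₁)
      (DelayHinf.posSemidef_of_symBlock hRS₂) (DelayHinf.posDef_PhiBar_of_GammaBar hΓ)
  have hUQ₁ : U * Q₁ = K * (X₀ * Q₃) := by
    rw [hK, nonsing_inv_mul_cancel_right _ _ ((isUnit_iff_isUnit_det _).1 hY)]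
  have hX₁Q₃ : X₁ * Q₃ = A₀ * (X₀ * Q₃) := by
    simp only [hX, Matrix.add_mul, Matrix.mul_assoc, hXhQ₃, hUQ₃, Matrix.mul_zero, add_zero]
  have hX₁Q₂ : X₁ * Q₂ = A₁ * (X₀ * Q₃) := by
    simp only [hX, Matrix.add_mul, Matrix.mul_assoc, hXhQ₂, hUQ₂, hX₀Q₂, Matrix.mul_zero,
      add_zero, zero_add]
  have hX₁Q₁ : X₁ * Q₁ = B * K * (X₀ * Q₃) := by
    simp only [hX, Matrix.add_mul, Matrix.mul_assoc, hXhQ₁, hX₀Q₁, hUQ₁, Matrix.mul_zero, zero_add]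
  obtain ⟨V, hV⟩ := DelayHinf.exists_isStrictStorage hh₁ hh₂ hP hS hΓ hRS₁ hRS₂ hY hX₁Q₃ hX₁Q₂
    hX₁Q₁ hUQ₁
  exact ⟨hV.isExpStable, hV.l2Gain_lt hγ⟩

theorem corollary2 (n m p q T hbar d₁ d₂ : ℕ)
    (A₀ A₁ : Matrix (Fin n) (Fin n) ℝ) (B : Matrix (Fin n) (Fin m) ℝ)
    (D₀ : Matrix (Fin n) (Fin p) ℝ)
    (L₁ L₂ : Matrix (Fin q) (Fin n) ℝ) (D : Matrix (Fin q) (Fin m) ℝ)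
    -- recorded data, produced by the undisturbed system with constant delays `d₁`, `d₂`
    (hd₁ : d₁ ≤ hbar) (hd₂ : d₂ ≤ hbar)
    (ud : ℤ → Fin m → ℝ) (xd : ℤ → Fin n → ℝ)
    (hdata : DelayHinf.IsRecordedData A₀ A₁ B d₁ d₂ T ud xd)
    (U : Matrix (Fin m) (Fin T) ℝ) (Xh X₀ X₁ : Matrix (Fin n) (Fin T) ℝ)
    (hU : U = DelayHinf.dataMatrix (DelayHinf.delayed ud d₂) 0 T)
    (hXh : Xh = DelayHinf.dataMatrix (DelayHinf.delayed xd d₁) 0 T)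
    (hX₀ : X₀ = DelayHinf.dataMatrix xd 0 T)
    (hX₁ : X₁ = DelayHinf.dataMatrix xd 1 T)
    (hrank : (DelayHinf.dataW U Xh X₀).rank = m + 2 * n)
    -- constants and decision variables
    (γ ε : ℝ) (hhbar : 0 < hbar) (hγ : 0 < γ) (hε : 0 < ε)
    (P S R₁ R₂ S₁ S₂ : Matrix (Fin n) (Fin n) ℝ) (Q₁ Q₂ Q₃ : Matrix (Fin T) (Fin n) ℝ)
    (hP : P.PosDef) (hS : S.PosDef) (hR₁ : R₁.PosDef) (hR₂ : R₂.PosDef)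
    -- the data-based matrix inequalities
    (hΓ : (DelayHinf.GammaBar γ
      (DelayHinf.PsiBar (DelayHinf.PhiBar hbar ε X₀ X₁ P S R₁ R₂ S₁ S₂ Q₁ Q₂ Q₃)
        (DelayHinf.kappa L₁ L₂ D U X₀ Q₁ Q₃))
      (DelayHinf.kappa₂ q ε D₀)).PosDef)
    (hRS₁ : (DelayHinf.symBlock R₁ S₁ R₁).PosSemidef)
    (hRS₂ : (DelayHinf.symBlock R₂ S₂ R₂).PosSemidef)
    -- the equality constraints
    (hUQ₂ : U * Q₂ = 0) (hUQ₃ : U * Q₃ = 0)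
    (hXhQ₁ : Xh * Q₁ = 0) (hXhQ₃ : Xh * Q₃ = 0)
    (hX₀Q₁ : X₀ * Q₁ = 0) (hX₀Q₂ : X₀ * Q₂ = 0)
    (hXhQ₂ : Xh * Q₂ = X₀ * Q₃)
    -- the feedback gain
    (K : Matrix (Fin m) (Fin n) ℝ) (hK : K = U * Q₁ * (X₀ * Q₃)⁻¹) :
    ∀ h₁ h₂ : ℕ → ℕ, (∀ k, h₁ k ≤ hbar) → (∀ k, h₂ k ≤ hbar) →
      DelayHinf.IsExpStable A₀ A₁ B K D₀ hbar h₁ h₂ ∧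
      DelayHinf.l2Gain A₀ A₁ B K D₀ L₁ L₂ D hbar h₁ h₂ < ENNReal.ofReal γ := by
  intro h₁ h₂ hh₁ hh₂
  exact corollary2_general (by rw [hX₁, hX₀, hXh, hU]; exact hdata.dataMatrix_eq) hγ hP.posSemidef
    hS.posSemidef hΓ hRS₁ hRS₂ hUQ₂ hUQ₃ hXhQ₁ hXhQ₃ hX₀Q₁ hX₀Q₂ hXhQ₂ hK hh₁ hh₂
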